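/- Let $\Sigma$ be a finite alphabet and $S$ a finite set. Let $\mathcal S(\mathbb N^{\Sigma^*})$ be the $\mathbb R$-algebra of finite signed measures on the product $\sigma$-algebra of $\mathbb N^{\Sigma^*}$ (multisets of strings), where $\mu\,\&\,\nu$ is the pushforward of $\mu\otimes\nu$ under multiset union, with unit the Dirac measure at the empty multiset. A string $x\in\Sigma^*$ acts on it by pushforward along $\alpha\mapsto x\cdot\alpha=\{\!|xz\mid z\in\alpha|\!\}$, and $\varepsilon$ denotes the Dirac measure at the multiset containing the null string once. Let $FS=\mathbb R[\Sigma^*\cdot\varepsilon,\Sigma^*\cdot S]$ be the polynomial algebra in the indeterminates $x\cdot\varepsilon$ and $x\cdot s$ ($x\in\Sigma^*$, $s\in S$), on which $y\in\Sigma^*$ acts by $y\cdot(x\cdot\varepsilon)=yx\cdot\varepsilon$ and $y\cdot(x\cdot s)=yx\cdot s$; $s$ is identified with the indeterminate $x\cdot s$ for $x$ the null string, so that $\mathbb R[S]\subseteq FS$. For $V=FS$ or $V=\mathcal S(\mathbb N^{\Sigma^*})$, a map $f:S\to V$ extends to the algebra homomorphism $f^\ddag:FS\to V$ with $x\cdot\varepsilon\mapsto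 x\cdot\varepsilon$ and $x\cdot s\mapsto x\cdot f(s)$. An automaton is a map $\theta:S\to\mathbb R[\varepsilon,\Sigma\cdot S]\subseteq FS$ such that each polynomial $\theta(s)$ has nonnegative coefficients with sum $1$. For $x\in\Sigma^*$, let $x\cdot\theta:FS\to FS$ be the algebra homomorphism that sends $xz\cdot s$ to $x\cdot\theta^\ddag(z\cdot s)$ and fixes all $y\cdot\varepsilon$ and all $y\cdot s$ for which $x$ is not a prefix of $y$. A finite tree is a finite prefix-closed set $A\subseteq\Sigma^*$, and $\partial A$ is the set of prefix-minimal elements of $\Sigma^*\setminus A$. Define algebra homomorphisms $\theta_A:\mathbb R[S]\to FS$ by letting $\theta_\emptyset$ be the inclusion and $\theta_{A\cup\{x\}}=(x\cdot\theta)\circ\theta_A$ for $x\in\partial A$ (the order in which strings are added does not matter). Then for every automaton $\theta$ there is a unique family $(⟦s⟧)_{s\in S}$ of probability measures on $\mathbb N^{\Sigma^*}$ with $⟦-⟧=⟦-⟧^\ddag\circ\theta$ on $S$ (the semantics of the automaton), and for every finite tree $A$, $$⟦-⟧^\ddag\circ\theta_A=⟦-⟧^\ddag\quad\text{on }\mathbb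 R[S].$$ -/

import Mathlib

open MeasureTheory

noncomputable section

namespace PKA

/-! ### Multisets of strings, and finite trees of strings

Strings over `Γ` are elements of `List Γ`, and a multiset of strings with finite multiplicities is
a function `List Γ → ℕ`; its measurable structure is the product one, generated by the sets
of multisets with prescribed multiplicities on a finite set of strings. -/

/-- Multisets of strings over `Γ` with finite multiplicities. -/
abbrev Multi (Γ : Type*) : Type _ := List Γ → ℕ

open Classical in
/-- The action `x · α` of a string on a multiset: prepend `x` to each of its elements. -/
def prepend {Γ : Type*} (x : List Γ) : Multi Γ →+ Multi Γ where
  toFun α y := if x <+: y then α (y.drop x.length) else 0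
  map_zero' := by ext y; simp
  map_add' α β := by ext y; by_cases h : x <+: y <;> simp [h]

theorem measurable_prepend {Γ : Type*} (x : List Γ) : Measurable (prepend x) := by
  refine measurable_pi_lambda _ fun y => ?_
  by_cases h : x <+: y
  · simpa [prepend, h] using measurable_pi_apply (X := fun _ : List Γ => ℕ) (y.drop x.length)
  · simp [prepend, h]

theorem prepend_nil {Γ : Type*} (α : Multi Γ) : prepend [] α = α := by
  ext y; simp [prepend]

theorem prepend_append {Γ : Type*} (x y : List Γ) (α : Multi Γ) :
    prepend (x ++ y) α = prepend x (prepend y α) := by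
  ext z
  by_cases h : x <+: z
  · obtain ⟨w, rfl⟩ := h
    have h1 : x ++ y <+: x ++ w ↔ y <+: w := List.prefix_append_right_inj x
    have h2 : x <+: x ++ w := List.prefix_append x w
    have h3 : (x ++ w).drop x.length = w := List.drop_left
    have h4 : (x ++ w).drop (x ++ y).length = w.drop y.length := by
      rw [List.length_append, ← List.drop_drop, h3]
    by_cases h5 : y <+: w
    · have h6 := h1.2 h5
      simp only [prepend, AddMonoidHom.coe_mk, ZeroHom.coe_mk, h2, h3, h4, h5, h6, if_true]
    · have h6 := mt h1.1 h5
      simp only [prepend, AddMonoidHom.coe_mk, ZeroHom.coe_mk, h2, h3, h5, h6, if_true, if_false]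
  · have h' : ¬ (x ++ y) <+: z := fun hz => h ((List.prefix_append x y).trans hz)
    simp [prepend, h, h']

/-- A finite tree: a finite set of strings closed under prefixes. -/
def IsTree {Γ : Type*} (A : Finset (List Γ)) : Prop :=
  ∀ x y : List Γ, x <+: y → y ∈ A → x ∈ A

/-- The boundary `∂A`: the prefix-minimal elements of the complement of `A`. -/
def boundary {Γ : Type*} (A : Finset (List Γ)) : Set (List Γ) :=
  {x | x ∉ A ∧ ∀ y : List Γ, y <+: x → y ∉ A → y = x}

/-! ### The algebra of finite signed measures -/

/-- Finite signed measures on multisets of strings. -/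
abbrev Signed (Γ : Type*) : Type _ := SignedMeasure (Multi Γ)

namespace Signed

variable {Γ : Type*}

/-- A finite measure, viewed as a signed measure. -/
def ofMeasure (μ : Measure (Multi Γ)) [IsFiniteMeasure μ] : Signed Γ := μ.toSignedMeasure

/-- The product `μ & ν`: the pushforward of the product measure `μ ⊗ ν` under multiset union. -/
instance : Mul (Signed Γ) where
  mul μ ν := (VectorMeasure.prod μ ν (ContinuousLinearMap.mul ℝ ℝ)).map
    fun p : Multi Γ × Multi Γ => p.1 + p.2

/-- The unit: the Dirac measure at the empty multiset. -/
instance : One (Signed Γ) where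
  one := ofMeasure (Measure.dirac 0)

theorem finite_variation {X : Type*} [MeasurableSpace X] (μ : SignedMeasure X) :
    IsFiniteMeasure μ.variation := by
  rw [← SignedMeasure.totalVariation_eq_variation]
  unfold SignedMeasure.totalVariation
  infer_instance

theorem prod_rect (μ ν : SignedMeasure (Multi Γ)) (s t : Set (Multi Γ)) :
    VectorMeasure.prod μ ν (ContinuousLinearMap.mul ℝ ℝ) (s ×ˢ t) = μ s * ν t := by
  have := finite_variation μ
  simp

theorem add_mul' (a b c : Signed Γ) : (a + b) * c = a * c + b * c := by
  change VectorMeasure.map _ _ = VectorMeasure.map _ _ + VectorMeasure.map _ _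
  rw [← VectorMeasure.map_add]
  congr 1
  refine VectorMeasure.prod_eq_of_forall_apply_prod fun s t _ _ => ?_
  rw [FunLike.coe_add, Pi.add_apply, prod_rect, prod_rect]
  change _ = (a s + b s) * c t
  ring

theorem smul_mul' (r : ℝ) (a b : Signed Γ) : (r • a) * b = r • (a * b) := by
  change VectorMeasure.map _ _ = r • VectorMeasure.map _ _
  rw [← VectorMeasure.map_smul]
  congr 1
  refine VectorMeasure.prod_eq_of_forall_apply_prod fun s t _ _ => ?_
  rw [FunLike.coe_smul, Pi.smul_apply, prod_rect]
  change _ = (r * a s) * b t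
  simp [mul_assoc]

theorem mul_comm' (a b : Signed Γ) : a * b = b * a := by
  have h : VectorMeasure.prod a b
      (ContinuousLinearMap.mul ℝ ℝ) =
      (VectorMeasure.prod b a
      (ContinuousLinearMap.mul ℝ ℝ)).map Prod.swap := by
    refine VectorMeasure.prod_eq_of_forall_apply_prod fun s t hs ht => ?_
    rw [VectorMeasure.map_apply _ measurable_swap (hs.prod ht), Set.preimage_swap_prod, prod_rect]
    exact mul_comm _ _
  change VectorMeasure.map _ _ = VectorMeasure.map _ _
  rw [h]
  ext s hs
  have hm : Measurable fun p : Multi Γ × Multi Γ => p.1 + p.2 := by fun_prop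
  rw [VectorMeasure.map_apply _ hm hs, VectorMeasure.map_apply _ measurable_swap (hm hs),
    VectorMeasure.map_apply _ hm hs]
  congr 1
  ext p
  simp [add_comm]

theorem ofMeasure_mul (μ ν : Measure (Multi Γ)) [IsFiniteMeasure μ] [IsFiniteMeasure ν] :
    ofMeasure μ * ofMeasure ν = ofMeasure (μ.conv ν) := by
  have h : VectorMeasure.prod μ.toSignedMeasure ν.toSignedMeasure (ContinuousLinearMap.mul ℝ ℝ) =
      (μ.prod ν).toSignedMeasure := by
    refine VectorMeasure.prod_eq_of_forall_apply_prod fun s t hs ht => ?_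
    simp [hs, ht, hs.prod ht, measureReal_prod_prod]
  change VectorMeasure.map (VectorMeasure.prod μ.toSignedMeasure ν.toSignedMeasure
    (ContinuousLinearMap.mul ℝ ℝ)) _ = (μ.conv ν).toSignedMeasure
  rw [h]
  ext s hs
  have hm : Measurable fun p : Multi Γ × Multi Γ => p.1 + p.2 := by fun_prop
  rw [VectorMeasure.map_apply _ hm hs, Measure.toSignedMeasure_apply_measurable (hm hs),
    Measure.toSignedMeasure_apply_measurable hs, Measure.conv, map_measureReal_apply hm hs]

theorem exists_sub (a : Signed Γ) : ∃ (μ ν : Measure (Multi Γ)) (_ : IsFiniteMeasure μ)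
    (_ : IsFiniteMeasure ν), a = ofMeasure μ - ofMeasure ν :=
  ⟨_, _, (SignedMeasure.toJordanDecomposition a).posPart_finite,
    (SignedMeasure.toJordanDecomposition a).negPart_finite,
    (SignedMeasure.toSignedMeasure_toJordanDecomposition a).symm⟩

theorem neg_mul' (a b : Signed Γ) : -a * b = -(a * b) := by
  have := smul_mul' (-1) a b
  rwa [neg_one_smul ℝ a, neg_one_smul ℝ (a * b)] at this

theorem sub_mul' (a b c : Signed Γ) : (a - b) * c = a * c - b * c := by
  rw [sub_eq_add_neg, add_mul', neg_mul', ← sub_eq_add_neg]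

theorem mul_sub' (a b c : Signed Γ) : a * (b - c) = a * b - a * c := by
  rw [mul_comm', sub_mul', mul_comm' b, mul_comm' c]

theorem mul_assoc' (a b c : Signed Γ) : a * b * c = a * (b * c) := by
  obtain ⟨a₁, a₂, _, _, rfl⟩ := exists_sub a
  obtain ⟨b₁, b₂, _, _, rfl⟩ := exists_sub b
  obtain ⟨c₁, c₂, _, _, rfl⟩ := exists_sub c
  simp only [sub_mul', mul_sub', ofMeasure_mul, Measure.conv_assoc]

theorem one_mul' (a : Signed Γ) : 1 * a = a := by
  obtain ⟨a₁, a₂, _, _, rfl⟩ := exists_sub a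
  change ofMeasure (Measure.dirac 0) * _ = _
  simp only [mul_sub', ofMeasure_mul, Measure.dirac_zero_conv]

instance : CommRing (Signed Γ) where
  __ := (inferInstance : AddCommGroup (SignedMeasure (Multi Γ)))
  mul_assoc := mul_assoc'
  one_mul := one_mul'
  mul_one a := by rw [mul_comm', one_mul']
  left_distrib a b c := by rw [mul_comm', add_mul', mul_comm' b, mul_comm' c]
  right_distrib := add_mul'
  zero_mul a := by
    have := smul_mul' 0 a a
    rwa [zero_smul, zero_smul] at this
  mul_zero a := by
    have := smul_mul' 0 a a
    rw [mul_comm']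
    rwa [zero_smul, zero_smul] at this
  mul_comm := mul_comm'

instance : Algebra ℝ (Signed Γ) :=
  Algebra.ofModule smul_mul' fun r a b => by rw [mul_comm, smul_mul', mul_comm]

/-- The pushforward of a signed measure under `α ↦ x · α`. -/
def push (x : List Γ) (μ : Signed Γ) : Signed Γ :=
  VectorMeasure.map μ (prepend x)

theorem push_ofMeasure (x : List Γ) (μ : Measure (Multi Γ)) [IsFiniteMeasure μ] :
    push x (ofMeasure μ) = ofMeasure (μ.map (prepend x)) := by
  change VectorMeasure.map μ.toSignedMeasure _ = (μ.map (prepend x)).toSignedMeasure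
  ext s hs
  rw [VectorMeasure.map_apply _ (measurable_prepend x) hs,
    Measure.toSignedMeasure_apply_measurable (measurable_prepend x hs),
    Measure.toSignedMeasure_apply_measurable hs, map_measureReal_apply (measurable_prepend x) hs]

theorem push_add (x : List Γ) (a b : Signed Γ) : push x (a + b) = push x a + push x b :=
  VectorMeasure.map_add _ _ _

theorem push_smul (x : List Γ) (r : ℝ) (a : Signed Γ) : push x (r • a) = r • push x a :=
  VectorMeasure.map_smul _

theorem push_sub (x : List Γ) (a b : Signed Γ) : push x (a - b) = push x a - push x b := by
  rw [sub_eq_add_neg, sub_eq_add_neg, push_add, ← neg_one_smul ℝ b, push_smul, neg_one_smul]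

theorem push_mul (x : List Γ) (a b : Signed Γ) : push x (a * b) = push x a * push x b := by
  obtain ⟨a₁, a₂, _, _, rfl⟩ := exists_sub a
  obtain ⟨b₁, b₂, _, _, rfl⟩ := exists_sub b
  have h (μ ν : Measure (Multi Γ)) [IsFiniteMeasure μ] [IsFiniteMeasure ν] :
      (μ.conv ν).map (prepend x) = (μ.map (prepend x)).conv (ν.map (prepend x)) := by
    have hp := measurable_prepend x
    rw [Measure.conv, Measure.conv, Measure.map_prod_map _ _ hp hp,
      Measure.map_map hp (by fun_prop), Measure.map_map (by fun_prop) (hp.prodMap hp)]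
    congr 1
    ext p : 1
    simp
  simp only [push_sub, sub_mul, mul_sub, ofMeasure_mul, push_ofMeasure, h]

theorem push_one (x : List Γ) : push x (1 : Signed Γ) = 1 := by
  change push x (ofMeasure _) = ofMeasure _
  rw [push_ofMeasure]
  simp [Measure.map_dirac' (measurable_prepend x)]

end Signed

/-! ### Algebras with an action of strings -/

/-- An `ℝ`-algebra `V` with an action of the free monoid on `Γ` by algebra homomorphisms and with a
distinguished element `ε`. -/
class StringAlgebra (Γ : Type*) (V : Type*) [CommRing V] [Algebra ℝ V] where
  /-- The action `u ↦ x · u`. -/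
  act : List Γ → V →ₐ[ℝ] V
  /-- The distinguished element. -/
  eps : V
  act_nil : ∀ u : V, act [] u = u
  act_append : ∀ (x y : List Γ) (u : V), act (x ++ y) u = act x (act y u)

/-- Signed measures: the action is the pushforward along `x · -`, and the distinguished element is
the Dirac measure at the multiset containing the null string once. -/
instance (Γ : Type*) : StringAlgebra Γ (Signed Γ) where
  act x := AlgHom.ofLinearMap
    { toFun := Signed.push x
      map_add' := Signed.push_add x
      map_smul' := Signed.push_smul x }
    (Signed.push_one x) (Signed.push_mul x)
  eps := open Classical in Signed.ofMeasure (Measure.dirac (Pi.single [] 1))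
  act_nil μ := by
    change VectorMeasure.map _ _ = _
    rw [show ⇑(prepend ([] : List Γ)) = id from funext prepend_nil, VectorMeasure.map_id]
  act_append x y μ := by
    change VectorMeasure.map _ _ = VectorMeasure.map (VectorMeasure.map _ _) _
    ext s hs
    rw [VectorMeasure.map_apply _ (measurable_prepend _) hs,
      VectorMeasure.map_apply _ (measurable_prepend _) hs,
      VectorMeasure.map_apply _ (measurable_prepend _) (measurable_prepend _ hs)]
    congr 1
    ext α
    simp [prepend_append]

/-- The indeterminates `x · ε` and `x · s` of the free algebra. -/
inductive Indet (Γ S : Type*) where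
  | eps (x : List Γ) : Indet Γ S
  | state (x : List Γ) (s : S) : Indet Γ S

/-- The action of strings on indeterminates. -/
def Indet.shift {Γ S : Type*} (x : List Γ) : Indet Γ S → Indet Γ S
  | .eps y => .eps (x ++ y)
  | .state y s => .state (x ++ y) s

/-- The free algebra `ℝ[Σ*·ε, Σ*·S]` on generators `S`. -/
abbrev Free (Γ S : Type*) : Type _ := MvPolynomial (Indet Γ S) ℝ

instance (Γ S : Type*) : StringAlgebra Γ (Free Γ S) where
  act x := MvPolynomial.rename (Indet.shift x)
  eps := MvPolynomial.X (.eps [])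
  act_nil u := by
    have h : (Indet.shift [] : Indet Γ S → Indet Γ S) = id := by
      funext i; cases i <;> rfl
    rw [h, MvPolynomial.rename_id_apply]
  act_append x y u := by
    rw [MvPolynomial.rename_rename]
    congr 2
    funext i; cases i <;> simp [Indet.shift]

/-- The extension `f‡ : ℝ[Σ*·ε, Σ*·S] → V` of `f : S → V` to a morphism of algebras with string
action, sending `x · ε` to `x · ε` and `x · s` to `x · f s`. -/
def extend {Γ S V : Type*} [CommRing V] [Algebra ℝ V] [StringAlgebra Γ V] (f : S → V) :
    Free Γ S →ₐ[ℝ] V :=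
  MvPolynomial.aeval fun
    | .eps x => StringAlgebra.act x (StringAlgebra.eps Γ : V)
    | .state x s => StringAlgebra.act x (f s)

/-- The inclusion `ℝ[S] → ℝ[Σ*·ε, Σ*·S]`. -/
def incl (Γ S : Type*) : MvPolynomial S ℝ →ₐ[ℝ] Free Γ S :=
  MvPolynomial.rename (Indet.state [])

open Classical in
/-- The partial evaluation `x · h`: it replaces `y · s` by `x · h(z · s)` if `y = x z`, applies
`h` to the indeterminates `y · ε`, and fixes the other indeterminates. -/
def partialEval {Γ S : Type*} (x : List Γ) (h : Free Γ S →ₐ[ℝ] Free Γ S) :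
    Free Γ S →ₐ[ℝ] Free Γ S :=
  MvPolynomial.aeval fun
    | .eps y => h (MvPolynomial.X (.eps y))
    | .state y s =>
      if x <+: y then StringAlgebra.act x (h (MvPolynomial.X (.state (y.drop x.length) s)))
      else MvPolynomial.X (.state y s)

/-! ### Automata and their semantics -/

/-- A probabilistic automaton with states `S` over the alphabet `Γ`. The structure map sends a
state to a finitely supported probability distribution on multisets over `{ε} ⊔ Γ × S`, written as
a polynomial in `ℝ[ε, Σ·S]`; the indeterminate `none` is `ε`, and `some (a, s)` is `a · s`. -/
structure Automaton (Γ S : Type*) where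
  /-- The structure map, with values in `ℝ[ε, Σ·S]`. -/
  step : S → MvPolynomial (Option (Γ × S)) ℝ
  coeff_nonneg : ∀ s m, 0 ≤ (step s).coeff m
  sum_coeff : ∀ s, ∑ m ∈ (step s).support, (step s).coeff m = 1

namespace Automaton

variable {Γ S : Type*}

/-- The structure map `θ`, with values in the free algebra. -/
def struct (M : Automaton Γ S) (s : S) : Free Γ S :=
  MvPolynomial.rename
    (fun | none => Indet.eps [] | some (a, t) => Indet.state [a] t) (M.step s)

/-- The operator `τ(f) = f‡ ∘ θ`. -/
def tau (M : Automaton Γ S) (f : S → Signed Γ) : S → Signed Γ :=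
  fun s => extend f (M.struct s)

/-- A family of probability measures, as a family of signed measures. -/
def toSigned (f : S → ProbabilityMeasure (Multi Γ)) : S → Signed Γ :=
  fun s => Signed.ofMeasure (f s : Measure (Multi Γ))

/-- `f` is a fixpoint of `τ` among the families of probability measures. -/
def IsSemantics (M : Automaton Γ S) (f : S → ProbabilityMeasure (Multi Γ)) : Prop :=
  M.tau (toSigned f) = toSigned f

/-- The semantics `⟦-⟧` on states: the fixpoint of `τ`. -/
def sem (M : Automaton Γ S) : S → ProbabilityMeasure (Multi Γ) :=
  Classical.epsilon M.IsSemantics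

/-- The semantics on the free algebra, `⟦-⟧‡`. -/
def semHom (M : Automaton Γ S) : Free Γ S →ₐ[ℝ] Signed Γ :=
  extend (toSigned M.sem)

open Classical in
/-- `M.Unrolls A φ`: the map `φ` is obtained from the identity on `ℝ[S]` by adding the strings of
the tree `A` one at a time, each from the boundary of the tree built so far, and composing with
`x · θ` when `x` is added. -/
inductive Unrolls (M : Automaton Γ S) :
    Finset (List Γ) → (MvPolynomial S ℝ →ₐ[ℝ] Free Γ S) → Prop
  | base : Unrolls M ∅ (incl Γ S)
  | add {A : Finset (List Γ)} {φ : MvPolynomial S ℝ →ₐ[ℝ] Free Γ S} {x : List Γ} :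
      Unrolls M A φ → x ∈ boundary A →
      Unrolls M (insert x A) ((partialEval x (extend M.struct)).comp φ)

theorem isTree_insert {A : Finset (List Γ)} {x : List Γ} (hA : IsTree A) (hx : x ∈ boundary A) :
    open Classical in IsTree (insert x A) := by
  classical
  intro u v huv hv
  rcases Finset.mem_insert.1 hv with rfl | hv
  · by_cases hu : u ∈ A
    · exact Finset.mem_insert_of_mem hu
    · rw [hx.2 u huv hu]
      exact Finset.mem_insert_self _ _
  · exact Finset.mem_insert_of_mem (hA u v huv hv)

theorem Unrolls.isTree {M : Automaton Γ S} {A : Finset (List Γ)}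
    {φ : MvPolynomial S ℝ →ₐ[ℝ] Free Γ S} (h : M.Unrolls A φ) : IsTree A := by
  induction h with
  | base => intro x y _ hy; simp at hy
  | add _ hx ih => exact isTree_insert ih hx

open Classical in
/-- Removing a string which is not a proper prefix of another one. -/
theorem erase_maximal {A : Finset (List Γ)} (hA : IsTree A) {x : List Γ} (hxA : x ∈ A)
    (hx : ∀ y ∈ A, x <+: y → y = x) : IsTree (A.erase x) ∧ x ∈ boundary (A.erase x) := by
  refine ⟨fun u v huv hv => ?_, by simp, fun y hy hyA => ?_⟩
  · rw [Finset.mem_erase] at hv ⊢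
    refine ⟨?_, hA u v huv hv.2⟩
    rintro rfl
    exact hv.1 (hx v hv.2 huv)
  · by_contra hne
    exact hyA (Finset.mem_erase.2 ⟨hne, hA y x hy hxA⟩)

theorem Unrolls.exists_of_isTree (M : Automaton Γ S) (A : Finset (List Γ)) (hA : IsTree A) :
    ∃ φ, M.Unrolls A φ := by
  classical
  induction hn : A.card generalizing A with
  | zero =>
    rw [Finset.card_eq_zero] at hn
    subst hn
    exact ⟨_, .base⟩
  | succ n ih =>
    obtain ⟨x, hxA, hx⟩ := A.exists_max_image List.length
      (Finset.card_pos.1 (by omega))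
    have hx' : ∀ y ∈ A, x <+: y → y = x := fun y hy hxy =>
      (hxy.eq_of_length_le (hx y hy)).symm
    obtain ⟨h1, h2⟩ := erase_maximal hA hxA hx'
    obtain ⟨φ, hφ⟩ := ih (A.erase x) h1 (by rw [Finset.card_erase_of_mem hxA]; omega)
    have := hφ.add h2
    rw [Finset.insert_erase hxA] at this
    exact ⟨_, this⟩

theorem partialEval_shift_of_incomparable (x y : List Γ) (h : Free Γ S →ₐ[ℝ] Free Γ S)
    (heps : ∀ z, h (MvPolynomial.X (.eps z)) = MvPolynomial.X (.eps z))
    (hxy : ¬ x <+: y) (hyx : ¬ y <+: x) (p : Free Γ S) :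
    partialEval x h (StringAlgebra.act y p) = StringAlgebra.act y p := by
  have key : ((partialEval x h).comp (StringAlgebra.act y)) =
      (StringAlgebra.act y : Free Γ S →ₐ[ℝ] Free Γ S) := by
    apply MvPolynomial.algHom_ext
    rintro (z | ⟨z, s⟩)
    · simp [partialEval, StringAlgebra.act, Indet.shift, heps]
    · have hn : ¬ x <+: y ++ z := fun hz =>
        (List.prefix_or_prefix_of_prefix hz (List.prefix_append y z)).elim hxy hyx
      simp [partialEval, StringAlgebra.act, Indet.shift, hn]
  exact DFunLike.congr_fun key p

theorem extend_struct_eps (M : Automaton Γ S) (z : List Γ) :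
    extend (Γ := Γ) M.struct (MvPolynomial.X (.eps z)) = MvPolynomial.X (.eps z) := by
  simp [extend, StringAlgebra.act, StringAlgebra.eps, Indet.shift]

theorem partialEval_comm (M : Automaton Γ S) {x y : List Γ} (hxy : ¬ x <+: y) (hyx : ¬ y <+: x) :
    (partialEval x (extend M.struct)).comp (partialEval y (extend M.struct)) =
      (partialEval y (extend M.struct)).comp (partialEval x (extend M.struct)) := by
  have hX (w z : List Γ) (s : S) (p : Free Γ S →ₐ[ℝ] Free Γ S) :
      partialEval w p (MvPolynomial.X (.state z s)) = open Classical in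
        if w <+: z then StringAlgebra.act w (p (MvPolynomial.X (.state (z.drop w.length) s)))
        else MvPolynomial.X (.state z s) := by
    simp [partialEval]
  have hE (w z : List Γ) : partialEval w (extend M.struct) (MvPolynomial.X (.eps z)) =
      MvPolynomial.X (.eps z) := by
    simp [partialEval, extend_struct_eps]
  apply MvPolynomial.algHom_ext
  rintro (z | ⟨z, s⟩)
  · simp [hE]
  · rw [AlgHom.comp_apply, AlgHom.comp_apply]
    by_cases h1 : x <+: z
    · have h2 : ¬ y <+: z := fun h2 =>
        (List.prefix_or_prefix_of_prefix h1 h2).elim hxy hyx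
      rw [hX y, if_neg h2, hX x, if_pos h1,
        partialEval_shift_of_incomparable y x _ (extend_struct_eps M) hyx hxy]
    · rw [hX x z, if_neg h1, hX y]
      by_cases h2 : y <+: z
      · rw [if_pos h2, partialEval_shift_of_incomparable x y _ (extend_struct_eps M) hxy hyx]
      · rw [if_neg h2, hX x, if_neg h1]

theorem not_prefix_of_boundary {A : Finset (List Γ)} (hA : IsTree A) {x y : List Γ}
    (hx : x ∈ boundary A) (hy : y ∈ A) : ¬ x <+: y := fun h => hx.1 (hA x y h hy)

/-- The order in which the strings of a tree are added is irrelevant. -/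
theorem Unrolls.unique (M : Automaton Γ S) {A : Finset (List Γ)}
    {φ ψ : MvPolynomial S ℝ →ₐ[ℝ] Free Γ S} (hφ : M.Unrolls A φ) (hψ : M.Unrolls A ψ) : φ = ψ := by
  classical
  induction hn : A.card using Nat.strong_induction_on generalizing A φ ψ with
  | _ n ih =>
    generalize hB : A = B at hψ
    cases hφ with
    | base =>
      cases hψ with
      | base => rfl
      | @add B' ψ' y hψ' hy =>
        exact absurd hB.symm (Finset.insert_ne_empty _ _)
    | @add A₁ φ₁ x h₁ hx =>
      cases hψ with
      | base => exact absurd hB (Finset.insert_ne_empty _ _)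
      | @add A₂ ψ₂ y h₂ hy =>
        have hcx : (insert x A₁).card = A₁.card + 1 := Finset.card_insert_of_notMem hx.1
        have hcy : (insert y A₂).card = A₂.card + 1 := Finset.card_insert_of_notMem hy.1
        have he₁ : A₁ = (insert x A₁).erase x := (Finset.erase_insert hx.1).symm
        have he₂ : A₂ = (insert y A₂).erase y := (Finset.erase_insert hy.1).symm
        rw [← hB] at hcy he₂
        by_cases hxy : x = y
        · subst hxy
          have h12 : A₁ = A₂ := he₁.trans he₂.symm
          subst h12
          rw [ih _ (by omega) h₁ h₂ rfl]
        · have hy₁ : y ∈ A₁ := by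
            have : y ∈ insert x A₁ := hB ▸ Finset.mem_insert_self y A₂
            exact (Finset.mem_insert.1 this).resolve_left (Ne.symm hxy)
          have hx₂ : x ∈ A₂ := by
            have : x ∈ insert y A₂ := hB ▸ Finset.mem_insert_self x A₁
            exact (Finset.mem_insert.1 this).resolve_left hxy
          have hnxy := not_prefix_of_boundary h₁.isTree hx hy₁
          have hnyx := not_prefix_of_boundary h₂.isTree hy hx₂
          have hmax₁ : ∀ z ∈ A₁, y <+: z → z = y := by
            intro z hz hyz
            have hz' : z ∈ insert y A₂ := hB ▸ Finset.mem_insert_of_mem hz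
            rcases Finset.mem_insert.1 hz' with h | h
            · exact h
            · exact absurd hyz (not_prefix_of_boundary h₂.isTree hy h)
          have hmax₂ : ∀ z ∈ A₂, x <+: z → z = x := by
            intro z hz hxz
            have hz' : z ∈ insert x A₁ := hB ▸ Finset.mem_insert_of_mem hz
            rcases Finset.mem_insert.1 hz' with h | h
            · exact h
            · exact absurd hxz (not_prefix_of_boundary h₁.isTree hx h)
          obtain ⟨hC, hyC⟩ := erase_maximal h₁.isTree hy₁ hmax₁
          obtain ⟨_, hxC⟩ := erase_maximal h₂.isTree hx₂ hmax₂
          have hCeq : A₂.erase x = A₁.erase y := by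
            rw [he₂, Finset.erase_right_comm, ← he₁]
          rw [hCeq] at hxC
          obtain ⟨χ, hχ⟩ := Unrolls.exists_of_isTree M _ hC
          have hφ₁ := hχ.add hyC
          rw [Finset.insert_erase hy₁] at hφ₁
          have hψ₂ := hχ.add hxC
          rw [← hCeq, Finset.insert_erase hx₂] at hψ₂
          rw [ih _ (by omega) h₁ hφ₁ rfl, ih _ (by omega) h₂ hψ₂ rfl, ← AlgHom.comp_assoc,
            ← AlgHom.comp_assoc, partialEval_comm M hnxy hnyx]

open Classical in
/-- The map `θ_A : ℝ[S] → ℝ[Σ*·ε, Σ*·S]` (the identity if `A` is not a tree). -/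
def structTree (M : Automaton Γ S) (A : Finset (List Γ)) : MvPolynomial S ℝ →ₐ[ℝ] Free Γ S :=
  if h : ∃ φ, M.Unrolls A φ then h.choose else incl Γ S

theorem structTree_eq (M : Automaton Γ S) {A : Finset (List Γ)}
    {φ : MvPolynomial S ℝ →ₐ[ℝ] Free Γ S} (h : M.Unrolls A φ) : M.structTree A = φ := by
  have h' : ∃ φ, M.Unrolls A φ := ⟨φ, h⟩
  rw [structTree, dif_pos h']
  exact h'.choose_spec.unique M h

theorem structTree_empty (M : Automaton Γ S) : M.structTree ∅ = incl Γ S :=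
  M.structTree_eq .base

open Classical in
theorem structTree_insert (M : Automaton Γ S) {A : Finset (List Γ)} (hA : IsTree A) {x : List Γ}
    (hx : x ∈ boundary A) : M.structTree (insert x A) =
      (partialEval x (extend M.struct)).comp (M.structTree A) := by
  obtain ⟨φ, hφ⟩ := Unrolls.exists_of_isTree M A hA
  rw [M.structTree_eq hφ, M.structTree_eq (hφ.add hx)]

end Automaton

end PKA

end

open MeasureTheory Filter Topology

noncomputable section

namespace PKA

/-! ### Truncation of multisets -/

/-! In `θ(s)` every state occurs behind exactly one letter. Hence the restriction of `τ(f)` to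
strings of length less than `n + 1` depends only on the restrictions of the `f t` to strings of
length less than `n`: `τ` is contractive for the ultrametric given by truncations (`truncHom_tau`).
It preserves probability measures, since `τ(f)(s)` is a convex combination of convolution products
of probability measures (`IsProb.aeval`).

Uniqueness of the fixpoint follows because a finite measure on a product is determined by its finite
marginals, and hence by its truncations (`measure_ext_trunc`). For existence, the truncations of the
iterates of `τ` become stationary, so each coordinate has only finitely many marginals along the
sequence. The sequence is therefore tight, and Prokhorov's theorem gives a cluster point with the
prescribed truncations (`exists_limit_of_trunc`), which contraction shows to be a fixpoint.

Invariance under unrolling is algebraic: if `τ(f) = f`, then `f‡` absorbs each partial evaluation `x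
· θ`, as one sees on indeterminates (`extend_comp_partialEval`). Induction on the construction of
`θ_A` finishes the proof. -/

/-- The restriction of a multiset to the strings of length less than `n`. -/
def trunc {Γ : Type*} (n : ℕ) : Multi Γ →+ Multi Γ where
  toFun α y := if y.length < n then α y else 0
  map_zero' := by ext y; simp
  map_add' α β := by ext y; by_cases h : y.length < n <;> simp [h]

theorem trunc_apply {Γ : Type*} (n : ℕ) (α : Multi Γ) (y : List Γ) :
    trunc n α y = if y.length < n then α y else 0 := rfl

theorem continuous_trunc {Γ : Type*} (n : ℕ) : Continuous (trunc n : Multi Γ → Multi Γ) := by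
  refine continuous_pi fun y => ?_
  by_cases h : y.length < n
  · simpa [trunc_apply, h] using continuous_apply (A := fun _ : List Γ => ℕ) y
  · simpa [trunc_apply, h] using continuous_const

theorem measurable_trunc {Γ : Type*} (n : ℕ) : Measurable (trunc n : Multi Γ → Multi Γ) := by
  refine measurable_pi_lambda _ fun y => ?_
  by_cases h : y.length < n
  · simpa [trunc_apply, h] using measurable_pi_apply (X := fun _ : List Γ => ℕ) y
  · simp [trunc_apply, h]

theorem trunc_zero {Γ : Type*} (α : Multi Γ) : trunc 0 α = 0 := by
  ext y; simp [trunc_apply]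

theorem trunc_trunc {Γ : Type*} {m n : ℕ} (h : m ≤ n) (α : Multi Γ) :
    trunc m (trunc n α) = trunc m α := by
  ext y
  simp only [trunc_apply]
  split_ifs <;> first | rfl | omega

/-- The index shift here is the source of contraction: prepending one letter raises every length by
exactly one. -/
theorem trunc_succ_prepend {Γ : Type*} (n : ℕ) (a : Γ) (α : Multi Γ) :
    trunc (n + 1) (prepend [a] α) = prepend [a] (trunc n α) := by
  ext y
  by_cases h : [a] <+: y
  · obtain ⟨w, rfl⟩ := h
    simp [trunc_apply, prepend]
  · simp [trunc_apply, prepend, h]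

theorem restrict_comp_trunc {Γ : Type*} (J : Finset (List Γ)) :
    -- The `+ 1` is needed because `trunc` keeps only strings strictly shorter than its index.
    J.restrict ∘ trunc (J.sup List.length + 1) =
      (J.restrict : Multi Γ → (∀ _ : J, ℕ)) := by
  ext α ⟨y, hy⟩
  have : y.length ≤ J.sup List.length := Finset.le_sup hy
  simp [trunc_apply, Nat.lt_succ_of_le this]

/-- A finite measure on multisets is determined by its truncations. -/
theorem measure_ext_trunc {Γ : Type*} {μ ν : Measure (Multi Γ)} [IsFiniteMeasure μ]
    (h : ∀ n, μ.map (trunc n) = ν.map (trunc n)) : μ = ν := by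
  -- Finite-dimensional marginals determine the measure, and each of them factors through a
  -- truncation.
  refine IsProjectiveLimit.unique (P := fun J : Finset (List Γ) => μ.map J.restrict)
    (fun _ => rfl) fun J => ?_
  have hJ : Measurable (J.restrict : Multi Γ → (∀ _ : J, ℕ)) := J.measurable_restrict
  change ν.map J.restrict = μ.map J.restrict
  rw [← restrict_comp_trunc J, ← Measure.map_map hJ (measurable_trunc _),
    ← Measure.map_map hJ (measurable_trunc _), h]

/-! ### Pushforward along additive maps -/

namespace Signed

variable {Γ : Type*}

theorem ofMeasure_injective {μ ν : Measure (Multi Γ)} [IsFiniteMeasure μ] [IsFiniteMeasure ν]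
    (h : ofMeasure μ = ofMeasure ν) : μ = ν :=
  Measure.toSignedMeasure_eq_toSignedMeasure_iff.mp h

theorem ofMeasure_congr {μ ν : Measure (Multi Γ)} [IsFiniteMeasure μ] [IsFiniteMeasure ν]
    (h : μ = ν) : ofMeasure μ = ofMeasure ν := by
  subst h; rfl

theorem map_ofMeasure {φ : Multi Γ →+ Multi Γ} (hφ : Measurable φ) (μ : Measure (Multi Γ))
    [IsFiniteMeasure μ] : VectorMeasure.map (ofMeasure μ) φ = ofMeasure (μ.map φ) := by
  ext s hs
  rw [VectorMeasure.map_apply _ hφ hs]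
  change μ.toSignedMeasure _ = (μ.map φ).toSignedMeasure _
  rw [Measure.toSignedMeasure_apply_measurable (hφ hs),
    Measure.toSignedMeasure_apply_measurable hs, map_measureReal_apply hφ hs]

theorem map_sub' (φ : Multi Γ → Multi Γ) (a b : Signed Γ) :
    (VectorMeasure.map (a - b) φ : Signed Γ) =
      VectorMeasure.map a φ - VectorMeasure.map b φ := by
  rw [sub_eq_add_neg, sub_eq_add_neg, ← neg_one_smul ℝ b, VectorMeasure.map_add,
    VectorMeasure.map_smul, neg_one_smul]

/-- By bilinearity and the Jordan decomposition it suffices to treat positive measures, where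
additivity of `φ` lets it pass through multiset union. -/
theorem map_mul' {φ : Multi Γ →+ Multi Γ} (hφ : Measurable φ) (a b : Signed Γ) :
    (VectorMeasure.map (a * b) φ : Signed Γ) =
      (VectorMeasure.map a φ : Signed Γ) * VectorMeasure.map b φ := by
  obtain ⟨a₁, a₂, _, _, rfl⟩ := exists_sub a
  obtain ⟨b₁, b₂, _, _, rfl⟩ := exists_sub b
  have h (μ ν : Measure (Multi Γ)) [IsFiniteMeasure μ] [IsFiniteMeasure ν] :
      (μ.conv ν).map φ = (μ.map φ).conv (ν.map φ) := by
    rw [Measure.conv, Measure.conv, Measure.map_prod_map _ _ hφ hφ,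
      Measure.map_map hφ (by fun_prop), Measure.map_map (by fun_prop) (hφ.prodMap hφ)]
    congr 1
    ext p : 1
    simp
  simp only [map_sub', sub_mul, mul_sub, ofMeasure_mul, map_ofMeasure hφ, h]

/-- The pushforward along a measurable additive map, as an algebra homomorphism. -/
def mapHom (φ : Multi Γ →+ Multi Γ) (hφ : Measurable φ) : Signed Γ →ₐ[ℝ] Signed Γ :=
  AlgHom.ofLinearMap
    { toFun := fun μ => VectorMeasure.map μ φ
      map_add' := fun _ _ => VectorMeasure.map_add _ _ _
      map_smul' := fun _ _ => VectorMeasure.map_smul _ }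
    (by
      change VectorMeasure.map (ofMeasure _) φ = ofMeasure _
      rw [map_ofMeasure hφ]
      exact ofMeasure_congr (by rw [Measure.map_dirac' hφ, map_zero]))
    (map_mul' hφ)

/-- The truncation of signed measures. -/
def truncHom (n : ℕ) : Signed Γ →ₐ[ℝ] Signed Γ := mapHom (trunc n) (measurable_trunc n)

theorem truncHom_ofMeasure (n : ℕ) (μ : Measure (Multi Γ)) [IsFiniteMeasure μ] :
    truncHom n (ofMeasure μ) = ofMeasure (μ.map (trunc n)) :=
  map_ofMeasure (measurable_trunc n) μ

theorem truncHom_ofMeasure_eq_iff {n : ℕ} {μ ν : Measure (Multi Γ)} [IsFiniteMeasure μ]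
    [IsFiniteMeasure ν] :
    truncHom n (ofMeasure μ) = truncHom n (ofMeasure ν) ↔ μ.map (trunc n) = ν.map (trunc n) := by
  rw [truncHom_ofMeasure, truncHom_ofMeasure]
  exact ⟨ofMeasure_injective, ofMeasure_congr⟩

theorem truncHom_succ_act (n : ℕ) (a : Γ) (μ : Signed Γ) :
    truncHom (n + 1) (StringAlgebra.act [a] μ) = StringAlgebra.act [a] (truncHom n μ) := by
  change VectorMeasure.map (VectorMeasure.map μ (prepend [a])) (trunc (n + 1)) =
    VectorMeasure.map (VectorMeasure.map μ (trunc n)) (prepend [a])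
  have hp := measurable_prepend [a]
  have ht := measurable_trunc (Γ := Γ)
  ext s hs
  rw [VectorMeasure.map_apply _ (ht _) hs, VectorMeasure.map_apply _ hp (ht _ hs),
    VectorMeasure.map_apply _ hp hs, VectorMeasure.map_apply _ (ht _) (hp hs)]
  congr 1
  ext α
  simp [trunc_succ_prepend]

/-! ### Probability measures among signed measures -/

/-- The signed measure `a` is a probability measure. -/
def IsProb (a : Signed Γ) : Prop :=
  ∃ μ : ProbabilityMeasure (Multi Γ), a = ofMeasure (μ : Measure (Multi Γ))

theorem IsProb.of_measure (μ : Measure (Multi Γ)) [h : IsProbabilityMeasure μ] :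
    IsProb (ofMeasure μ) := ⟨⟨μ, h⟩, rfl⟩

theorem IsProb.one : IsProb (1 : Signed Γ) := IsProb.of_measure (Measure.dirac 0)

theorem IsProb.eps : IsProb (StringAlgebra.eps Γ : Signed Γ) := by
  classical exact IsProb.of_measure (Measure.dirac (Pi.single [] 1))

theorem IsProb.mul {a b : Signed Γ} (ha : IsProb a) (hb : IsProb b) : IsProb (a * b) := by
  obtain ⟨μ, rfl⟩ := ha
  obtain ⟨ν, rfl⟩ := hb
  rw [ofMeasure_mul]
  exact .of_measure _

theorem IsProb.act {a : Signed Γ} (ha : IsProb a) (x : List Γ) :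
    IsProb (StringAlgebra.act x a) := by
  obtain ⟨μ, rfl⟩ := ha
  have := Measure.isProbabilityMeasure_map (μ := (μ : Measure (Multi Γ)))
    (measurable_prepend x).aemeasurable
  change IsProb (push x _)
  rw [push_ofMeasure]
  exact .of_measure _

theorem convex_isProb : Convex ℝ {a : Signed Γ | IsProb a} := by
  rintro _ ⟨μ, rfl⟩ _ ⟨ν, rfl⟩ r t hr ht hrt
  lift r to NNReal using hr
  lift t to NNReal using ht
  have hrt' : (r : ENNReal) + t = 1 := by exact_mod_cast hrt
  have : IsProbabilityMeasure (r • (μ : Measure (Multi Γ)) + t • (ν : Measure (Multi Γ))) :=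
    ⟨by
      rw [Measure.add_apply, Measure.smul_apply, Measure.smul_apply, measure_univ, measure_univ,
        ENNReal.smul_def, ENNReal.smul_def, smul_eq_mul, smul_eq_mul, mul_one, mul_one, hrt']⟩
  have h : (r : ℝ) • ofMeasure (μ : Measure (Multi Γ)) + (t : ℝ) • ofMeasure (ν : Measure (Multi Γ))
      = ofMeasure (r • (μ : Measure (Multi Γ)) + t • (ν : Measure (Multi Γ))) := by
    change _ = Measure.toSignedMeasure _
    rw [Measure.toSignedMeasure_add, Measure.toSignedMeasure_smul, Measure.toSignedMeasure_smul]
    rfl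
  change IsProb _
  rw [h]
  exact .of_measure _

/-- Each monomial evaluates to a convolution product of probability measures, and the coefficients
are the weights of a convex combination. -/
theorem IsProb.aeval {σ : Type*} {g : σ → Signed Γ} (hg : ∀ i, IsProb (g i))
    {p : MvPolynomial σ ℝ} (hp : ∀ m, 0 ≤ p.coeff m) (hp1 : ∑ m ∈ p.support, p.coeff m = 1) :
    IsProb (MvPolynomial.aeval g p) := by
  have hpow (i : σ) (k : ℕ) : IsProb (g i ^ k) := by
    induction k with
    | zero => rw [pow_zero]; exact .one
    | succ k ih => rw [pow_succ]; exact ih.mul (hg i)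
  rw [p.as_sum, map_sum]
  simp only [MvPolynomial.aeval_monomial, ← Algebra.smul_def]
  exact convex_isProb.sum_mem (fun m _ => hp m) hp1 fun m _ =>
    Finset.prod_induction _ IsProb (fun _ _ => .mul) .one fun i _ => hpow i _

end Signed

/-! ### Sequences of probability measures with stationary truncations -/

/-- A single finite measure on a Polish space is tight, and tightness survives finite unions. -/
theorem isTightMeasureSet_of_finite {X : Type*} [MeasurableSpace X] [TopologicalSpace X]
    [TopologicalSpace.IsCompletelyPseudoMetrizableSpace X] [SecondCountableTopology X]
    [BorelSpace X] {T : Set (Measure X)} (hT : T.Finite) (h : ∀ μ ∈ T, IsFiniteMeasure μ) :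
    IsTightMeasureSet T := by
  induction T, hT using Set.Finite.induction_on with
  | empty => exact isTightMeasureSet_iff_exists_isCompact_measure_compl_le.2 fun _ _ =>
      ⟨∅, isCompact_empty, by simp⟩
  | @insert μ T _ _ ih =>
    have := h μ (Set.mem_insert _ _)
    exact (isTightMeasureSet_singleton (μ := μ)).union
      (ih fun ν hν => h ν (Set.mem_insert_of_mem _ hν))

/-- A set of measures on a countable product is tight if all its marginals are. -/
theorem isTightMeasureSet_pi {ι : Type*} [Countable ι] {X : ι → Type*}
    [∀ i, MeasurableSpace (X i)] [∀ i, TopologicalSpace (X i)] [∀ i, T2Space (X i)]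
    [∀ i, OpensMeasurableSpace (X i)] {T : Set (Measure (∀ i, X i))}
    (h : ∀ i, IsTightMeasureSet ((fun μ : Measure (∀ i, X i) => μ.map (Function.eval i)) '' T)) :
    IsTightMeasureSet T := by
  rw [isTightMeasureSet_iff_exists_isCompact_measure_compl_le]
  intro ε hε
  -- The error `ε` is distributed over the countably many coordinates; the compact set is then a
  -- box, by Tychonoff.
  obtain ⟨δ, hδ, hδε⟩ := ENNReal.exists_pos_sum_of_countable' hε.ne' ι
  have h' (i : ι) := isTightMeasureSet_iff_exists_isCompact_measure_compl_le.1 (h i) (δ i) (hδ i)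
  choose K hK hKδ using h'
  refine ⟨Set.univ.pi K, isCompact_univ_pi hK, fun μ hμ => ?_⟩
  have hc : (Set.univ.pi K)ᶜ ⊆ ⋃ i, Function.eval i ⁻¹' (K i)ᶜ := by
    intro x hx
    simpa [Set.mem_pi] using hx
  calc μ (Set.univ.pi K)ᶜ ≤ μ (⋃ i, Function.eval i ⁻¹' (K i)ᶜ) := measure_mono hc
    _ ≤ ∑' i, μ (Function.eval i ⁻¹' (K i)ᶜ) := measure_iUnion_le _
    _ ≤ ∑' i, δ i := ENNReal.tsum_le_tsum fun i => by
        rw [← Measure.map_apply (measurable_pi_apply i) (hK i).measurableSet.compl]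
        exact hKδ i _ ⟨μ, hμ, rfl⟩
    _ ≤ ε := hδε.le

theorem finite_range_of_eventually_const {X : Type*} {u : ℕ → X} {N : ℕ}
    (h : ∀ n, N ≤ n → u n = u N) : (Set.range u).Finite := by
  refine ((Set.finite_Iic N).image u).subset ?_
  rintro _ ⟨n, rfl⟩
  rcases le_total n N with hn | hn
  · exact ⟨n, hn, rfl⟩
  · exact ⟨N, Set.mem_Iic.2 le_rfl, (h n hn).symm⟩

/-- A sequence of probability measures with stationary truncations has a limit. -/
theorem exists_limit_of_trunc {Γ : Type*} [Countable Γ] (u : ℕ → ProbabilityMeasure (Multi Γ))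
    (hu : ∀ m n, m ≤ n → (u n : Measure (Multi Γ)).map (trunc m) =
      (u m : Measure (Multi Γ)).map (trunc m)) :
    ∃ μ : ProbabilityMeasure (Multi Γ), ∀ m, (μ : Measure (Multi Γ)).map (trunc m) =
      (u m : Measure (Multi Γ)).map (trunc m) := by
  have htight : IsTightMeasureSet
      {((μ : ProbabilityMeasure (Multi Γ)) : Measure (Multi Γ)) | μ ∈ Set.range u} := by
    refine isTightMeasureSet_pi fun y => isTightMeasureSet_of_finite ?_ ?_
    -- The coordinate `y` is visible to `trunc (y.length + 1)`, so its marginals are constant from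
    -- that index on.
    · have heval : (Function.eval y : Multi Γ → ℕ) = Function.eval y ∘ trunc (y.length + 1) := by
        ext α; simp [trunc_apply]
      refine (finite_range_of_eventually_const (N := y.length + 1)
        (u := fun n => (u n : Measure (Multi Γ)).map (Function.eval y)) fun n hn => ?_).subset ?_
      · rw [heval, ← Measure.map_map (measurable_pi_apply y) (measurable_trunc _), hu _ _ hn,
          Measure.map_map (measurable_pi_apply y) (measurable_trunc _)]
      · rintro _ ⟨_, ⟨_, ⟨n, rfl⟩, rfl⟩, rfl⟩
        exact ⟨n, rfl⟩
    · rintro _ ⟨_, ⟨_, ⟨n, rfl⟩, rfl⟩, rfl⟩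
      infer_instance
  -- Prokhorov: tightness makes the closure of the sequence compact, so there is a cluster point.
  obtain ⟨μ, -, hμ⟩ := (isCompact_closure_of_isTightMeasureSet htight).exists_mapClusterPt
    (f := atTop) (u := u) (tendsto_principal.2 (.of_forall fun n => subset_closure ⟨n, rfl⟩))
  refine ⟨μ, fun m => ?_⟩
  have hcont := ProbabilityMeasure.continuous_map (continuous_trunc (Γ := Γ) m)
  have hcl := hμ.continuousAt_comp hcont.continuousAt
  have hlim : Tendsto ((fun ν : ProbabilityMeasure (Multi Γ) =>
      ν.map (continuous_trunc m).measurable.aemeasurable) ∘ u) atTop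
      (𝓝 ((u m).map (continuous_trunc m).measurable.aemeasurable)) := by
    refine tendsto_const_nhds.congr' ?_
    filter_upwards [eventually_ge_atTop m] with n hn
    exact Subtype.ext (hu m n hn).symm
  -- The truncated sequence clusters at the truncation of `μ` and converges to that of `u m`. As the
  -- space is Hausdorff, the two coincide.
  have hne : (𝓝 (μ.map (continuous_trunc m).measurable.aemeasurable) ⊓
      𝓝 ((u m).map (continuous_trunc m).measurable.aemeasurable)).NeBot :=
    NeBot.mono hcl (inf_le_inf_left _ hlim)
  have heq := eq_of_nhds_neBot hne
  exact congrArg Subtype.val heq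

/-! ### The semantics -/

namespace Automaton

variable {Γ S : Type*} (M : Automaton Γ S)

open Signed

/-- This form displays the guard: every `f t` enters under the action of a single letter. -/
theorem tau_eq_aeval (f : S → Signed Γ) (s : S) :
    M.tau f s = MvPolynomial.aeval (fun
      | none => StringAlgebra.act ([] : List Γ) (StringAlgebra.eps Γ : Signed Γ)
      | some (a, t) => StringAlgebra.act [a] (f t)) (M.step s) := by
  rw [tau, extend, struct, MvPolynomial.aeval_rename]
  congr 2
  funext i
  rcases i with _ | ⟨a, t⟩ <;> rfl

theorem isProb_tau {f : S → Signed Γ} (hf : ∀ s, IsProb (f s)) (s : S) : IsProb (M.tau f s) := by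
  rw [tau_eq_aeval]
  refine IsProb.aeval ?_ (M.coeff_nonneg s) (M.sum_coeff s)
  rintro (_ | ⟨a, t⟩)
  · exact IsProb.eps.act []
  · exact (hf t).act [a]

/-- The operator `τ` is contractive for the ultrametric given by truncations. -/
theorem truncHom_tau {n : ℕ} {f g : S → Signed Γ}
    (h : ∀ s, truncHom n (f s) = truncHom n (g s)) (s : S) :
    truncHom (n + 1) (M.tau f s) = truncHom (n + 1) (M.tau g s) := by
  rw [tau_eq_aeval, tau_eq_aeval, ← AlgHom.comp_apply, ← AlgHom.comp_apply]
  -- Both sides are values at `M.step s` of algebra homomorphisms, so agreement on the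
  -- indeterminates suffices.
  refine DFunLike.congr_fun (MvPolynomial.algHom_ext fun i => ?_) _
  rcases i with _ | ⟨a, t⟩
  · simp
  · simp [truncHom_succ_act, h]

/-- Truncation at level zero remembers only the total mass, which is one on both sides. This starts
the inductions. -/
theorem truncHom_zero_eq (μ ν : ProbabilityMeasure (Multi Γ)) :
    truncHom 0 (ofMeasure (μ : Measure (Multi Γ))) =
      truncHom 0 (ofMeasure (ν : Measure (Multi Γ))) := by
  rw [truncHom_ofMeasure_eq_iff]
  have h : (trunc 0 : Multi Γ → Multi Γ) = fun _ => 0 := funext trunc_zero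
  simp [h, Measure.map_const]

theorem probabilityMeasure_ext_trunc {μ ν : ProbabilityMeasure (Multi Γ)}
    (h : ∀ n, truncHom n (ofMeasure (μ : Measure (Multi Γ))) =
      truncHom n (ofMeasure (ν : Measure (Multi Γ)))) : μ = ν :=
  Subtype.ext (measure_ext_trunc (μ := (μ : Measure (Multi Γ))) (ν := (ν : Measure (Multi Γ)))
    fun n => truncHom_ofMeasure_eq_iff.1 (h n))

theorem IsSemantics.unique {f g : S → ProbabilityMeasure (Multi Γ)} (hf : M.IsSemantics f)
    (hg : M.IsSemantics g) : f = g := by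
  have h (n : ℕ) : ∀ s, truncHom n (toSigned f s) = truncHom n (toSigned g s) := by
    induction n with
    | zero => exact fun s => truncHom_zero_eq _ _
    -- Each fixpoint is unfolded once, so that contraction gains one level.
    | succ n ih => rw [← hf, ← hg]; exact M.truncHom_tau ih
  funext s
  exact probabilityMeasure_ext_trunc fun n => h n s

/-- The operator `τ` on families of probability measures. -/
def probTau (f : S → ProbabilityMeasure (Multi Γ)) (s : S) : ProbabilityMeasure (Multi Γ) :=
  (M.isProb_tau (fun t => ⟨f t, rfl⟩ : ∀ t, IsProb (toSigned f t)) s).choose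

theorem toSigned_probTau (f : S → ProbabilityMeasure (Multi Γ)) :
    toSigned (M.probTau f) = M.tau (toSigned f) := by
  funext s
  exact (M.isProb_tau (fun t => ⟨f t, rfl⟩ : ∀ t, IsProb (toSigned f t)) s).choose_spec.symm

theorem exists_isSemantics [Countable Γ] :
    ∃ f : S → ProbabilityMeasure (Multi Γ), M.IsSemantics f := by
  -- Picard iteration; any initial family of probability measures would serve.
  let u (n : ℕ) : S → ProbabilityMeasure (Multi Γ) :=
    M.probTau^[n] fun _ => ⟨Measure.dirac 0, inferInstance⟩
  have hsucc (n : ℕ) : toSigned (u (n + 1)) = M.tau (toSigned (u n)) := by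
    rw [← toSigned_probTau]
    exact congrArg toSigned (Function.iterate_succ_apply' M.probTau n _)
  have hu (m : ℕ) : ∀ n, m ≤ n → ∀ s,
      truncHom m (toSigned (u n) s) = truncHom m (toSigned (u m) s) := by
    induction m with
    | zero => exact fun _ _ _ => truncHom_zero_eq _ _
    | succ m ih =>
      intro n hn
      -- Since `m + 1 ≤ n`, both iterates are values of `τ`, and contraction applies to their
      -- predecessors.
      obtain ⟨n, rfl⟩ := Nat.exists_eq_add_of_le' (Nat.one_le_of_lt hn)
      rw [hsucc, hsucc]
      exact M.truncHom_tau (ih n (by omega))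
  choose f hf using fun s => exists_limit_of_trunc (fun n => u n s) fun m n hmn =>
    truncHom_ofMeasure_eq_iff.1 (hu m n hmn s)
  have hf' (m : ℕ) (s : S) : truncHom m (toSigned f s) = truncHom m (toSigned (u m) s) :=
    truncHom_ofMeasure_eq_iff.2 (hf s m)
  have hfix : M.probTau f = f := by
    funext s
    refine probabilityMeasure_ext_trunc fun n => ?_
    change truncHom n (toSigned (M.probTau f) s) = truncHom n (toSigned f s)
    cases n with
    | zero => exact truncHom_zero_eq _ _
    -- At level `n + 1` the limit agrees with `u (n + 1) = τ(u n)`, which agrees with `τ(f)` because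
    -- `u n` and `f` agree at level `n`.
    | succ n => rw [toSigned_probTau, hf', hsucc, M.truncHom_tau (hf' n)]
  refine ⟨f, ?_⟩
  rw [IsSemantics, ← toSigned_probTau, hfix]

theorem isSemantics_sem [Countable Γ] : M.IsSemantics M.sem := by
  have : Nonempty (ProbabilityMeasure (Multi Γ)) := ⟨⟨Measure.dirac 0, inferInstance⟩⟩
  exact Classical.epsilon_spec M.exists_isSemantics

/-! ### Invariance under partial evaluation -/

theorem extend_act {V : Type*} [CommRing V] [Algebra ℝ V] [StringAlgebra Γ V] (f : S → V)
    (x : List Γ) (p : Free Γ S) :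
    extend f (StringAlgebra.act x p) = StringAlgebra.act x (extend f p) := by
  have key : (extend f).comp (StringAlgebra.act x : Free Γ S →ₐ[ℝ] Free Γ S) =
      (StringAlgebra.act x : V →ₐ[ℝ] V).comp (extend f) := by
    apply MvPolynomial.algHom_ext
    rintro (y | ⟨y, s⟩) <;> simp [extend, StringAlgebra.act, Indet.shift]
    all_goals exact StringAlgebra.act_append _ _ _
  exact DFunLike.congr_fun key p

theorem extend_X_state {V : Type*} [CommRing V] [Algebra ℝ V] [StringAlgebra Γ V] (f : S → V)
    (x : List Γ) (s : S) :
    extend f (MvPolynomial.X (.state x s)) = StringAlgebra.act x (f s) := by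
  simp [extend]

/-- On `xz · s` the left side gives `x · z · f‡(θ(s))` by equivariance of `f‡`, and the fixpoint
equation turns this into `xz · f(s)`. The remaining indeterminates are fixed by the partial
evaluation. -/
theorem extend_comp_partialEval {f : S → Signed Γ} (hf : M.tau f = f) (x : List Γ) :
    (extend f).comp (partialEval x (extend M.struct)) = extend f := by
  apply MvPolynomial.algHom_ext
  rintro (y | ⟨y, s⟩)
  · simp [partialEval, extend_struct_eps]
  · by_cases h : x <+: y
    · obtain ⟨z, rfl⟩ := h
      have hs : extend f (M.struct s) = f s := congrFun hf s
      simp only [AlgHom.comp_apply, partialEval, MvPolynomial.aeval_X, List.prefix_append, if_true,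
        List.drop_left, extend_X_state, extend_act, hs, StringAlgebra.act_append]
    · simp [partialEval, h]

/-- The partial evaluation added last is the outermost one, so `f‡` absorbs them one by one,
whatever the shape of the tree. -/
theorem Unrolls.extend_comp {M : Automaton Γ S} {f : S → Signed Γ} (hf : M.tau f = f)
    {A : Finset (List Γ)} {φ : MvPolynomial S ℝ →ₐ[ℝ] Free Γ S} (h : M.Unrolls A φ) :
    (extend f).comp φ = (extend f).comp (incl Γ S) := by
  induction h with
  | base => rfl
  | add _ _ ih => rw [← AlgHom.comp_assoc, M.extend_comp_partialEval hf, ih]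

end Automaton

end PKA

end

theorem mainTheorem6 {Γ S : Type*} [Finite Γ] [Finite S] (M : PKA.Automaton Γ S) :
    (M.IsSemantics M.sem ∧
      ∀ g : S → ProbabilityMeasure (PKA.Multi Γ), M.IsSemantics g → g = M.sem) ∧
    ∀ A : Finset (List Γ), PKA.IsTree A →
      M.semHom.comp (M.structTree A) = M.semHom.comp (PKA.incl Γ S) := by
  refine ⟨⟨M.isSemantics_sem, fun g hg => hg.unique M M.isSemantics_sem⟩, fun A hA => ?_⟩
  obtain ⟨φ, hφ⟩ := PKA.Automaton.Unrolls.exists_of_isTree M A hA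
  -- Independence of the order of insertion allows any unrolling of `A` to represent `θ_A`.
  rw [M.structTree_eq hφ]
  exact hφ.extend_comp M.isSemantics_sem
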